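/- **Lemma.** Let $p\ge 0$, $V=[p]=A_1\sqcup B_1=A_2\sqcup B_2$ with $A_1\cap A_2=\{j_1,j_2\}$, $j_1\neq j_2$. Place the elements of $V$ on a circle in their natural order, as the $p$-th roots of unity. *Ideals.* For $V=A\sqcup B$ let $I_{A,B,1}\subseteq\mathbb{R}[\sigma_{ij}: 1\le i<j\le p]$ be the ideal of invariants of the sparse one-factor model whose latent node has set of children $A$: all polynomials in the off-diagonal entries that vanish on every matrix $\Omega+\lambda\lambda^{\top}$ with $\Omega$ a positive definite diagonal $p\times p$ matrix and $\lambda\in\mathbb{R}^p$ supported on $A$. The join $I*J$ of two ideals of $\mathbb{R}[\mathbf{x}]$ is $\left(I(\mathbf{y}_1)+J(\mathbf{y}_2)+\langle y_{1i}+y_{2i}-x_i\rangle_i\right)\cap\mathbb{R}[\mathbf{x}]$, computed in $\mathbb{R}[\mathbf{x},\mathbf{y}_1,\mathbf{y}_2]$. *Circular term orders.* The class of an edge $ij$, $i<j$, is $\min(j-i,\,p-(j-i))$. A circular term order is a block term order $\prec$ whose blocks of variables are the classes, smaller classes first; that is, two monomials are compared through their parts in the first class in which they differ. In particular $\sigma_e\succ\sigma_f$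 whenever $e$ is in a smaller class than $f$. *Initial ideal graph.* $G_{A,B}$ is the simple graph with vertices $ij$, $\{i,j\}\subseteq V$, $i\ne j$, in which $\{ij,kl\}$ is an edge if and only if $i,j,k,l\in A$ and the chords $ij$ and $kl$ do not intersect (not even in an endpoint). *Glued hypergraph.* $G_{A_1,B_1}\times_V G_{A_2,B_2}$ has as hyperedges - of size 2: the edges of $G_{A_1,B_1}$ and of $G_{A_2,B_2}$ that do not contain the vertex $j_1j_2$; - of size 3: the sets $\{a,\,j_1j_2,\,b\}$ where $\{a,j_1j_2\}$ is an edge of $G_{A_1,B_1}$ and $\{j_1j_2,b\}$ is an edge of $G_{A_2,B_2}$. Its vertices are all $ij$ with $\{i,j\}\subseteq V$, $i\ne j$, except for those with $\{i,j\}\subseteq A_1$ or $\{i,j\}\subseteq A_2$ that lie in no hyperedge. The monomial edge ideal of a hypergraph is generated by the monomials $\prod_{v\in e}\sigma_v$, $e$ a hyperedge, together with the variables $\sigma_v$, $v$ an isolated vertex (a vertex that lies in no hyperedge). *Claim.* The ideals $I_{A_1,B_1,1}$ and $I_{A_2,B_2,1}$ are toric: $I_{A_s,B_s,1}$ is the kernel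 of the ring homomorphism $\mathbb{R}[\sigma_{ij}]\to\mathbb{R}[t_1,\dots,t_p]$ with $\sigma_{ij}\mapsto t_it_j$ if $i,j\in A_s$ and $\sigma_{ij}\mapsto 0$ otherwise. For every circular term order $\prec$, the join $\mathrm{in}_\prec(I_{A_1,B_1,1})*\mathrm{in}_\prec(I_{A_2,B_2,1})$ is the monomial edge ideal of the glued hypergraph $G_{A_1,B_1}\times_V G_{A_2,B_2}$. -/

import Mathlib

open scoped MonomialOrder

noncomputable section

namespace SparseFactor

/-! ### Factor analysis models and their ideals of invariants -/

/-- A factor analysis graph with latent nodes `H` and observed nodes `V`: a directed graph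
all of whose edges point from a latent to an observed node. -/
structure FactorGraph (H V : Type*) where
  /-- the set `D` of directed edges -/
  D : Set (H × V)

/-- The factor analysis model `F(G)`: the set of covariance matrices `Ω + Λ Λᵀ` with `Ω` diagonal
and positive definite and `Λ` a real `V × H` matrix with support in the edge set. -/
def FactorGraph.model {H V : Type*} [Fintype H] [DecidableEq V] (G : FactorGraph H V) :
    Set (Matrix V V ℝ) :=
  {S | ∃ (ω : V → ℝ) (L : Matrix V H ℝ), (∀ v, 0 < ω v) ∧ (∀ v h, (h, v) ∉ G.D → L v h = 0) ∧
    S = Matrix.diagonal ω + L * L.transpose}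

/-- The edges `ij`, `i < j`, of the complete graph on `p` vertices. They index the variables
`σ_{ij}` and are the vertices of the initial ideal graphs. -/
abbrev Pair (p : ℕ) : Type := {e : Fin p × Fin p // e.1 < e.2}

/-- The edge `e = ij` has both ends in `A`. -/
def Pair.In {p : ℕ} (e : Pair p) (A : Finset (Fin p)) : Prop := e.1.1 ∈ A ∧ e.1.2 ∈ A

/-- The ideal of invariants of the model of `G`, in the ring `ℝ[σ_{ij}, i < j]`: all polynomials
in the off-diagonal entries that vanish on every matrix of the model. -/
def FactorGraph.invariants {H : Type*} [Fintype H] {p : ℕ} (G : FactorGraph H (Fin p)) :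
    Ideal (MvPolynomial (Pair p) ℝ) where
  carrier := {f | ∀ S ∈ G.model, MvPolynomial.eval (fun e : Pair p => S e.1.1 e.1.2) f = 0}
  add_mem' := by
    intro f g hf hg S hS
    rw [map_add, hf S hS, hg S hS, add_zero]
  zero_mem' := fun _ _ => map_zero _
  smul_mem' := by
    intro c f hf S hS
    rw [smul_eq_mul, map_mul, hf S hS, mul_zero]

/-- The factor analysis graph with one latent node, whose set of children is `A`. -/
def oneFactorGraph {p : ℕ} (A : Finset (Fin p)) : FactorGraph Unit (Fin p) where
  D := {d | d.2 ∈ A}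

/-- The ideal of invariants `I_{A,B,1}` of the sparse one-factor model in which `A` is the set of
children of the latent node and `B = [p] ∖ A`. -/
def oneFactorIdeal {p : ℕ} (A : Finset (Fin p)) : Ideal (MvPolynomial (Pair p) ℝ) :=
  (oneFactorGraph A).invariants

/-- The complete graph on `A` together with the isolated vertices `[p] ∖ A`. -/
def completeOn {p : ℕ} (A : Finset (Fin p)) : SimpleGraph (Fin p) where
  Adj i j := i ≠ j ∧ i ∈ A ∧ j ∈ A
  symm := ⟨fun _ _ h => ⟨h.1.symm, h.2.2, h.2.1⟩⟩
  loopless := ⟨fun _ h => h.1 rfl⟩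

open Classical in
/-- The toric ideal of (the edge subring of) a graph `G` on `[p]`: the kernel of the ring
homomorphism that sends `σ_{ij}` to `t_i t_j` if `ij` is an edge of `G`, and to `0` otherwise. -/
def toricIdeal {p : ℕ} (G : SimpleGraph (Fin p)) : Ideal (MvPolynomial (Pair p) ℝ) :=
  RingHom.ker (MvPolynomial.aeval (R := ℝ) fun e : Pair p =>
    if G.Adj e.1.1 e.1.2 then (MvPolynomial.X e.1.1 * MvPolynomial.X e.1.2 :
      MvPolynomial (Fin p) ℝ) else 0)

/-! ### Circular term orders and initial ideals -/

/-- The class of the edge `ij`, when the vertices are the `p`-th roots of unity in their natural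
circular order: the circular distance of its ends. Two edges are in the same class if and only if
they are in the same orbit of the dihedral group, and edges closer to the boundary have smaller
class. -/
def Pair.circClass {p : ℕ} (e : Pair p) : ℕ :=
  min ((e.1.2 : ℕ) - (e.1.1 : ℕ)) (p - ((e.1.2 : ℕ) - (e.1.1 : ℕ)))

/-- The part of a monomial (given by its exponent vector) in the variables of block `d`, where
`c` assigns to each variable the number of its block. -/
def blockPart {σ : Type*} (c : σ → ℕ) (d : ℕ) (a : σ →₀ ℕ) : σ →₀ ℕ := a.filter fun s => c s = d

/-- `m` is the block (product) term order for the blocks `{s | c s = d}`, `d = 0, 1, 2, …`, taken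
in this order: monomials are compared through their parts in the first block in which they
differ. -/
def IsBlockOrder {σ : Type*} (c : σ → ℕ) (m : MonomialOrder σ) : Prop :=
  ∀ a b : σ →₀ ℕ, a ≺[m] b ↔
    ∃ d, (∀ d' < d, blockPart c d' a = blockPart c d' b) ∧ blockPart c d a ≺[m] blockPart c d b

/-- A circular term order: a block term order whose blocks are the classes of edges, with
`σ_e ≻ σ_f` whenever `e` is in a smaller class than `f`. -/
def IsCircular {p : ℕ} (m : MonomialOrder (Pair p)) : Prop :=
  IsBlockOrder Pair.circClass m ∧
    ∀ e f : Pair p, e.circClass < f.circClass → Finsupp.single f 1 ≺[m] Finsupp.single e 1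

/-- The initial ideal: the ideal generated by the leading terms of all elements of `I`. -/
def initialIdeal {σ K : Type*} [Field K] (m : MonomialOrder σ) (I : Ideal (MvPolynomial σ K)) :
    Ideal (MvPolynomial σ K) :=
  Ideal.span (m.leadingTerm '' (I : Set (MvPolynomial σ K)))

/-! ### The join of two ideals -/

/-- The join `I ∗ J`. In the ring `K[x, y₁, y₂]`, whose variables `x i`, `y₁ i`, `y₂ i` are indexed
by the three summands of `σ ⊕ σ ⊕ σ`, take the ideal `I(y₁) + J(y₂) + ⟨y₁ i + y₂ i - x i⟩`, and
intersect it with `K[x]`. -/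
def idealJoin {σ K : Type*} [Field K] (I J : Ideal (MvPolynomial σ K)) :
    Ideal (MvPolynomial σ K) :=
  let x : σ → σ ⊕ σ ⊕ σ := Sum.inl
  let y₁ : σ → σ ⊕ σ ⊕ σ := fun i => Sum.inr (Sum.inl i)
  let y₂ : σ → σ ⊕ σ ⊕ σ := fun i => Sum.inr (Sum.inr i)
  Ideal.comap (MvPolynomial.rename (R := K) x)
    (Ideal.map (MvPolynomial.rename (R := K) y₁) I ⊔ Ideal.map (MvPolynomial.rename (R := K) y₂) J ⊔
      Ideal.span (Set.range fun i : σ =>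
        (MvPolynomial.X (y₁ i) + MvPolynomial.X (y₂ i) - MvPolynomial.X (x i) :
          MvPolynomial (σ ⊕ σ ⊕ σ) K)))

/-! ### Initial ideal graphs, the glued hypergraph, and edge ideals -/

/-- Two edges cross when, with the vertices placed on a circle in their natural order, the chords
intersect: they share an end, or the ends of one separate the ends of the other. For edges with
ends in `A` it does not matter whether all vertices or only those of `A` are placed on the
circle. -/
def Pair.Cross {p : ℕ} (e f : Pair p) : Prop :=
  (e.1.1 = f.1.1 ∨ e.1.1 = f.1.2 ∨ e.1.2 = f.1.1 ∨ e.1.2 = f.1.2) ∨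
  (e.1.1 < f.1.1 ∧ f.1.1 < e.1.2 ∧ e.1.2 < f.1.2) ∨
  (f.1.1 < e.1.1 ∧ e.1.1 < f.1.2 ∧ f.1.2 < e.1.2)

theorem Pair.Cross.symm {p : ℕ} {e f : Pair p} (h : e.Cross f) : f.Cross e := by
  rcases h with (h | h | h | h) | h | h
  · exact Or.inl (Or.inl h.symm)
  · exact Or.inl (Or.inr (Or.inr (Or.inl h.symm)))
  · exact Or.inl (Or.inr (Or.inl h.symm))
  · exact Or.inl (Or.inr (Or.inr (Or.inr h.symm)))
  · exact Or.inr (Or.inr h)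
  · exact Or.inr (Or.inl h)

/-- The initial ideal graph `G_{A,B}` with `B = [p] ∖ A`: its vertices are all `ij` with
`i, j ∈ [p]`, and it joins two of them when both are edges of the complete graph on `A` and they
do not cross. -/
def initialIdealGraph {p : ℕ} (A : Finset (Fin p)) : SimpleGraph (Pair p) where
  Adj e f := e.In A ∧ f.In A ∧ ¬ e.Cross f
  symm := ⟨fun _ _ h => ⟨h.2.1, h.1, fun hc => h.2.2 hc.symm⟩⟩
  loopless := ⟨fun _ h => h.2.2 (Or.inl (Or.inl rfl))⟩

/-- The hyperedges of the glued hypergraph, where `e₀ = j₁j₂` is the vertex at which the two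
initial ideal graphs are glued. Size 2: the edges of the two graphs that do not contain `e₀`.
Size 3: the sets `{a, e₀, b}` with `a` a neighbour of `e₀` in the first graph and `b` a neighbour
of `e₀` in the second. -/
def gluedEdges {p : ℕ} (A₁ A₂ : Finset (Fin p)) (e₀ : Pair p) : Set (Set (Pair p)) :=
  {s | ∃ a b, ((initialIdealGraph A₁).Adj a b ∨ (initialIdealGraph A₂).Adj a b) ∧
      a ≠ e₀ ∧ b ≠ e₀ ∧ s = {a, b}} ∪
  {s | ∃ a b, (initialIdealGraph A₁).Adj a e₀ ∧ (initialIdealGraph A₂).Adj e₀ b ∧ s = {a, e₀, b}}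

/-- The glued hypergraph `G_{A₁,B₁} ×_V G_{A₂,B₂}`. Its vertices are all `ij`, except for those
edges of the complete graphs on `A₁` and on `A₂` that lie in no hyperedge. -/
def gluedHypergraph {p : ℕ} (A₁ A₂ : Finset (Fin p)) (e₀ : Pair p) : Hypergraph (Pair p) where
  vertexSet := {v | ¬ ((v.In A₁ ∨ v.In A₂) ∧ ∀ s ∈ gluedEdges A₁ A₂ e₀, v ∉ s)}
  edgeSet := gluedEdges A₁ A₂ e₀
  subset_vertexSet_of_mem_edgeSet' := fun s hs _ hv h => h.2 s hs hv

/-- The monomial edge ideal of a hypergraph with isolated vertices: it is generated by the products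
of the variables over the (finite) hyperedges, together with the variables of the isolated
vertices. -/
def monomialEdgeIdeal {σ : Type*} (K : Type*) [Field K] (H : Hypergraph σ) :
    Ideal (MvPolynomial σ K) :=
  Ideal.span
    ({f | ∃ s : Finset σ, (s : Set σ) ∈ H.edgeSet ∧ f = ∏ v ∈ s, MvPolynomial.X v} ∪
      {f | ∃ v ∈ H.vertexSet, H.IsIsolated v ∧ f = MvPolynomial.X v})

end SparseFactor

end

namespace SparseFactor

open MvPolynomial Finsupp

/-! ### Pairwise crossing multisets of chords are determined by their vertex degrees -/

/-! The off-diagonal entries of a one-factor covariance matrix are `λ_i λ_j`, so vanishing on the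
model means vanishing of the monomial parametrization at every real point, hence as a polynomial
(`oneFactorIdeal_eq_toricIdeal`).

The initial ideal rests on two facts about chords. Replacing two non-crossing chords by the
diagonals on the same four ends lowers a monomial in a circular order (`exists_uncross`,
`IsBlockOrder.single_add_single_lt`), so non-crossing pairs are leading terms of binomials. A
pairwise crossing multiset is determined by its vertex degrees
(`PairwiseCross.eq_of_vertexDegree_eq`), so its monomial is the least with its image and cannot lead
an element of the kernel. Hence `initialIdeal_toricIdeal`.

For the join, a monomial outside the edge ideal has support `F ∪ G` or smaller, with `F` and `G`
spanning coordinate subspaces in the zero sets of the two initial ideals (`exists_crossing_cover`).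
Elements of the join vanish on the sum of these subspaces and so omit that monomial. Conversely,
substituting `x = y₁ + y₂` into a generator of the edge ideal and expanding leaves only terms in the
two ideals. -/

/-- The number of ends at each vertex of a multiset of chords. -/
noncomputable def vertexDegree {p : ℕ} (a : Pair p →₀ ℕ) : Fin p →₀ ℕ :=
  a.sum fun e k => k • (single e.1.1 1 + single e.1.2 1)

theorem vertexDegree_add {p : ℕ} (a b : Pair p →₀ ℕ) :
    vertexDegree (a + b) = vertexDegree a + vertexDegree b := by
  classical
  exact Finsupp.sum_add_index' (by simp) (by intros; rw [add_smul])

theorem vertexDegree_single {p : ℕ} (e : Pair p) :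
    vertexDegree (single e 1) = single e.1.1 1 + single e.1.2 1 := by
  simp [vertexDegree]

theorem vertexDegree_apply {p : ℕ} (a : Pair p →₀ ℕ) (v : Fin p) :
    vertexDegree a v =
      ∑ e, a e * ((if e.1.1 = v then 1 else 0) + if e.1.2 = v then 1 else 0) := by
  rw [vertexDegree, Finsupp.sum_fintype _ _ (by simp), Finsupp.finsetSum_apply]
  simp [single_apply, mul_add]

/-- The chords of a monomial pairwise intersect. -/
def PairwiseCross {p : ℕ} (a : Pair p →₀ ℕ) : Prop :=
  ∀ e f, a e ≠ 0 → a f ≠ 0 → e.Cross f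

/-- The number of chords whose first end is at most `x` and whose second end is at most `y`. -/
def lowerCount {p : ℕ} (a : Pair p →₀ ℕ) (x y : ℕ) : ℕ :=
  ∑ e, if (e.1.1 : ℕ) ≤ x ∧ (e.1.2 : ℕ) ≤ y then a e else 0

theorem lowerCount_congr {p : ℕ} (a : Pair p →₀ ℕ) {x x' y y' : ℕ}
    (h : ∀ e, a e ≠ 0 → (((e.1.1 : ℕ) ≤ x ∧ (e.1.2 : ℕ) ≤ y) ↔
      ((e.1.1 : ℕ) ≤ x' ∧ (e.1.2 : ℕ) ≤ y'))) :
    lowerCount a x y = lowerCount a x' y' := by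
  refine Finset.sum_congr rfl fun e _ => ?_
  by_cases he : a e = 0
  · simp [he]
  · simp only [h e he]

/-- Every end is less than `p`, so the bound `p` imposes no condition: the right side counts first
ends and second ends separately. -/
theorem sum_vertexDegree_le {p : ℕ} (a : Pair p →₀ ℕ) (x : ℕ) :
    ∑ v : Fin p, (if (v : ℕ) ≤ x then vertexDegree a v else 0) =
      lowerCount a x p + lowerCount a p x := by
  have h : ∀ v : Fin p, (if (v : ℕ) ≤ x then vertexDegree a v else 0) =
      ∑ e : Pair p, ((if e.1.1 = v then (if (v : ℕ) ≤ x then a e else 0) else 0) +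
        (if e.1.2 = v then (if (v : ℕ) ≤ x then a e else 0) else 0)) := by
    intro v
    rw [vertexDegree_apply]
    split_ifs with hv
    · refine Finset.sum_congr rfl fun e _ => ?_
      rw [mul_add, mul_ite, mul_ite, mul_one, mul_zero]
    · simp
  rw [Finset.sum_congr rfl fun v _ => h v, Finset.sum_comm, lowerCount, lowerCount,
    ← Finset.sum_add_distrib]
  refine Finset.sum_congr rfl fun e _ => ?_
  rw [Finset.sum_add_distrib, Finset.sum_ite_eq, Finset.sum_ite_eq]
  have h1 := e.1.1.isLt
  have h2 := e.1.2.isLt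
  simp [h1.le, h2.le]

/-- Without nested chords, first and second ends increase together, so their joint distribution is
the minimum of the marginals. -/
theorem PairwiseCross.lowerCount_eq_min {p : ℕ} {a : Pair p →₀ ℕ} (h : PairwiseCross a)
    (x y : ℕ) : lowerCount a x y = min (lowerCount a x p) (lowerCount a p y) := by
  by_cases hx : ∀ e, a e ≠ 0 → (e.1.1 : ℕ) ≤ x → (e.1.2 : ℕ) ≤ y
  · have h1 : lowerCount a x y = lowerCount a x p := lowerCount_congr a fun e he => by
      have := hx e he
      have := e.1.2.isLt
      omega
    have h2 : lowerCount a x y ≤ lowerCount a p y := by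
      refine Finset.sum_le_sum fun e _ => ?_
      have := e.1.1.isLt
      split_ifs <;> omega
    omega
  · push Not at hx
    obtain ⟨e, he, hex, hey⟩ := hx
    -- A chord ending by `y` but starting after `x` would be nested inside `e`.
    have h1 : lowerCount a x y = lowerCount a p y := lowerCount_congr a fun f hf => by
      have hc := h e f he hf
      have h1 := e.2
      have h2 := f.2
      have := f.1.1.isLt
      simp only [Pair.Cross, Fin.ext_iff, Fin.lt_def] at hc h1 h2
      omega
    have h2 : lowerCount a x y ≤ lowerCount a x p := by
      refine Finset.sum_le_sum fun e _ => ?_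
      have := e.1.2.isLt
      split_ifs <;> omega
    omega

/-- Without disjoint chords, no first end comes after a second end. Hence the first marginal can be
read off from the cumulative vertex degrees. -/
theorem PairwiseCross.lowerCount_fst {p : ℕ} {a : Pair p →₀ ℕ} (h : PairwiseCross a) (x : ℕ) :
    lowerCount a x p = min (lowerCount a x p + lowerCount a p x) (lowerCount a p p) := by
  have hle : lowerCount a x p ≤ lowerCount a p p := by
    refine Finset.sum_le_sum fun e _ => ?_
    have := e.1.1.isLt
    split_ifs <;> omega
  by_cases h0 : lowerCount a p x = 0
  · omega
  · obtain ⟨f, -, hf⟩ := Finset.exists_ne_zero_of_sum_ne_zero h0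
    rw [ne_eq, ite_eq_right_iff, Classical.not_imp] at hf
    have : lowerCount a x p = lowerCount a p p := lowerCount_congr a fun e he => by
      have hc := h e f he hf.2
      have h1 := e.2
      have h2 := f.2
      have := e.1.1.isLt
      simp only [Pair.Cross, Fin.ext_iff, Fin.lt_def] at hc h1 h2
      omega
    omega

theorem eq_of_lowerCount_eq {p : ℕ} {a b : Pair p →₀ ℕ}
    (h : ∀ x y, lowerCount a x y = lowerCount b x y) : a = b := by
  have key : ∀ n : ℕ, ∀ e : Pair p, (e.1.1 : ℕ) + e.1.2 = n → a e = b e := by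
    -- Induction on the sum of the two ends: all other chords counted at the corner of `e` have a
    -- smaller sum.
    intro n
    induction n using Nat.strong_induction_on with
    | _ n ih =>
      intro e he
      have h1 := h e.1.1 e.1.2
      rw [lowerCount, lowerCount, ← Finset.add_sum_erase _ _ (Finset.mem_univ e),
        ← Finset.add_sum_erase _ _ (Finset.mem_univ e)] at h1
      rw [Finset.sum_congr rfl (g := fun f : Pair p =>
        if (f.1.1 : ℕ) ≤ e.1.1 ∧ (f.1.2 : ℕ) ≤ e.1.2 then b f else 0)] at h1
      · simpa using h1
      · intro f hf
        split_ifs with hfe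
        · refine ih _ ?_ f rfl
          have hne : f ≠ e := Finset.ne_of_mem_erase hf
          have : ¬ ((f.1.1 : ℕ) = e.1.1 ∧ (f.1.2 : ℕ) = e.1.2) := fun hh =>
            hne (Subtype.ext (Prod.ext (Fin.ext hh.1) (Fin.ext hh.2)))
          omega
        · rfl
  exact Finsupp.ext fun e => key _ e rfl

/-- Degrees give the marginals, the marginals give the joint counts, and the joint counts give the
multiplicities. -/
theorem PairwiseCross.eq_of_vertexDegree_eq {p : ℕ} {a b : Pair p →₀ ℕ} (ha : PairwiseCross a)
    (hb : PairwiseCross b) (h : vertexDegree a = vertexDegree b) : a = b := by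
  have hD : ∀ x, lowerCount a x p + lowerCount a p x = lowerCount b x p + lowerCount b p x :=
    fun x => by rw [← sum_vertexDegree_le, ← sum_vertexDegree_le, h]
  -- At `p` both summands are the total number of chords, so the totals agree.
  have hp := hD p
  have h1 : ∀ x, lowerCount a x p = lowerCount b x p := fun x => by
    have := hD x
    have := ha.lowerCount_fst x
    have := hb.lowerCount_fst x
    omega
  have h2 : ∀ x, lowerCount a p x = lowerCount b p x := fun x => by
    have := hD x
    have := h1 x
    omega
  exact eq_of_lowerCount_eq fun x y => by
    rw [ha.lowerCount_eq_min, hb.lowerCount_eq_min, h1, h2]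

/-! ### Circular term orders select the non-crossing pair -/

/-- The first block in which the two products differ is `min (c e) (c f)`. There the smaller product
has part `1`, which lies below any other monomial. -/
theorem IsBlockOrder.single_add_single_lt {σ : Type*} {c : σ → ℕ} {m : MonomialOrder σ}
    (hm : IsBlockOrder c m) {e f g h : σ} (hg : min (c e) (c f) < c g)
    (hh : min (c e) (c f) < c h) :
    single g 1 + single h 1 ≺[m] single e 1 + single f 1 := by
  classical
  have part : ∀ (d : ℕ) (s t : σ), d < c s → d < c t →
      blockPart c d (single s 1 + single t 1) = 0 := by
    intro d s t hs ht
    rw [blockPart, filter_add, filter_single_of_neg (fun s => c s = d) hs.ne',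
      filter_single_of_neg (fun s => c s = d) ht.ne', add_zero]
  refine (hm _ _).2 ⟨min (c e) (c f), fun d' hd' => ?_, ?_⟩
  · rw [part _ _ _ (hd'.trans hg) (hd'.trans hh), part _ _ _ (by omega) (by omega)]
  · rw [part _ _ _ hg hh, map_zero, m.toSyn_lt_iff_ne_zero, ne_eq, m.toSyn_eq_zero_iff]
    intro h0
    rcases min_choice (c e) (c f) with hc | hc
    · have := DFunLike.congr_fun h0 e
      simp [blockPart, hc] at this
    · have := DFunLike.congr_fun h0 f
      simp [blockPart, hc] at this

/-- Two non-crossing chords can be replaced by two chords on the same ends in larger classes. -/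
theorem exists_uncross {p : ℕ} {A : Finset (Fin p)} {e f : Pair p} (he : e.In A) (hf : f.In A)
    (hc : ¬ e.Cross f) :
    ∃ g h : Pair p, g.In A ∧ h.In A ∧ min e.circClass f.circClass < g.circClass ∧
      min e.circClass f.circClass < h.circClass ∧
      vertexDegree (single g 1 + single h 1) = vertexDegree (single e 1 + single f 1) := by
  wlog hlt : e.1.1 < f.1.1 generalizing e f
  · have hne : e.1.1 ≠ f.1.1 := fun h => hc (Or.inl (Or.inl h))
    obtain ⟨g, h, h1, h2, h3, h4, h5⟩ := this hf he (fun h => hc h.symm) (by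
      simp only [Fin.lt_def, Fin.ext_iff, ne_eq] at *; omega)
    exact ⟨g, h, h1, h2, by rwa [min_comm], by rwa [min_comm], by rw [h5, add_comm]⟩
  obtain ⟨⟨i, j⟩, hij⟩ := e
  obtain ⟨⟨k, l⟩, hkl⟩ := f
  have hi := i.isLt
  have hj := j.isLt
  have hk := k.isLt
  have hl := l.isLt
  simp only [Pair.Cross, Fin.lt_def, Fin.ext_iff] at hij hkl hlt hc
  -- The chords are disjoint or nested intervals; on the circle both cases are opposite sides of a
  -- quadrilateral. Each arc of a diagonal strictly contains the arc cut off by one of these sides,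
  -- whence the inequalities between classes.
  rcases lt_or_ge (j : ℕ) (k : ℕ) with h | h
  · refine ⟨⟨(i, k), hlt⟩, ⟨(j, l), show (j : ℕ) < l by omega⟩, ⟨he.1, hf.1⟩, ⟨he.2, hf.2⟩, ?_, ?_, ?_⟩
    · simp only [Pair.circClass]; omega
    · simp only [Pair.circClass]; omega
    · simp only [vertexDegree_add, vertexDegree_single]; abel
  · refine ⟨⟨(i, l), show (i : ℕ) < l by omega⟩, ⟨(k, j), show (k : ℕ) < j by omega⟩, ⟨he.1, hf.2⟩,
      ⟨hf.1, he.2⟩, ?_, ?_, ?_⟩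
    · simp only [Pair.circClass]; omega
    · simp only [Pair.circClass]; omega
    · simp only [vertexDegree_add, vertexDegree_single]; abel

/-! ### The toric parametrization -/

open Classical in
/-- The toric parametrization of the edge ring of the complete graph on `A`. -/
noncomputable def toricHom {p : ℕ} (A : Finset (Fin p)) :
    MvPolynomial (Pair p) ℝ →ₐ[ℝ] MvPolynomial (Fin p) ℝ :=
  aeval fun e : Pair p => if (completeOn A).Adj e.1.1 e.1.2 then X e.1.1 * X e.1.2 else 0

theorem mem_toricIdeal {p : ℕ} {A : Finset (Fin p)} {f : MvPolynomial (Pair p) ℝ} :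
    f ∈ toricIdeal (completeOn A) ↔ toricHom A f = 0 := Iff.rfl

theorem completeOn_adj {p : ℕ} {A : Finset (Fin p)} {e : Pair p} :
    (completeOn A).Adj e.1.1 e.1.2 ↔ e.In A :=
  ⟨fun h => h.2, fun h => ⟨e.2.ne, h⟩⟩

open Classical in
theorem toricHom_X {p : ℕ} (A : Finset (Fin p)) (e : Pair p) :
    toricHom A (X e) = if e.In A then X e.1.1 * X e.1.2 else 0 := by
  simp only [toricHom, aeval_X, completeOn_adj]

theorem eval_toricHom {p : ℕ} (A : Finset (Fin p)) (f : MvPolynomial (Pair p) ℝ) (t : Fin p → ℝ) :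
    eval t (toricHom A f) = eval (fun e : Pair p =>
      (if e.1.1 ∈ A then t e.1.1 else 0) * (if e.1.2 ∈ A then t e.1.2 else 0)) f := by
  classical
  have : (aeval t).comp (toricHom A) = (aeval fun e : Pair p =>
      (if e.1.1 ∈ A then t e.1.1 else 0) * (if e.1.2 ∈ A then t e.1.2 else 0)) := by
    refine MvPolynomial.algHom_ext fun e => ?_
    rw [AlgHom.comp_apply, toricHom_X, aeval_X]
    by_cases h1 : e.1.1 ∈ A <;> by_cases h2 : e.1.2 ∈ A <;> simp [Pair.In, h1, h2]
  exact DFunLike.congr_fun this f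

/-- `Ω` does not affect off-diagonal entries, so any positive choice, here the identity, realizes
every point of the parametrization. -/
theorem oneFactorIdeal_eq_toricIdeal {p : ℕ} (A : Finset (Fin p)) :
    oneFactorIdeal A = toricIdeal (completeOn A) := by
  ext f
  rw [mem_toricIdeal]
  constructor
  · intro hf
    refine MvPolynomial.funext fun t => ?_
    rw [map_zero, eval_toricHom]
    have := hf (Matrix.diagonal 1 + (Matrix.of fun v (_ : Unit) => if v ∈ A then t v else 0) *
        (Matrix.of fun v (_ : Unit) => if v ∈ A then t v else 0).transpose)
      ⟨1, Matrix.of fun v _ => if v ∈ A then t v else 0, fun _ => one_pos,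
        fun v _ hv => if_neg hv, rfl⟩
    refine Eq.trans ?_ this
    congr 2
    funext e
    rw [Matrix.add_apply, Matrix.diagonal_apply_ne _ e.2.ne]
    simp [Matrix.mul_apply]
  · rintro hf S ⟨ω, L, -, hL, rfl⟩
    have := eval_toricHom A f fun v => L v ()
    rw [hf, map_zero] at this
    rw [this]
    congr 2
    funext e
    have h : ∀ v, (if v ∈ A then L v () else 0) = L v () := fun v => by
      split_ifs with hv
      · rfl
      · exact (hL v () hv).symm
    rw [Matrix.add_apply, Matrix.diagonal_apply_ne _ e.2.ne, h, h]
    simp [Matrix.mul_apply]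

theorem toricHom_monomial {p : ℕ} {A : Finset (Fin p)} {d : Pair p →₀ ℕ}
    (hd : ∀ e, d e ≠ 0 → e.In A) (c : ℝ) :
    toricHom A (monomial d c) = monomial (vertexDegree d) c := by
  classical
  rw [toricHom, aeval_monomial, monomial_eq (s := vertexDegree d)]
  change C c * _ = _
  congr 1
  have h1 : (vertexDegree d).prod (fun v k => (X v : MvPolynomial (Fin p) ℝ) ^ k) =
      monomial (vertexDegree d) 1 := by rw [monomial_eq, C_1, one_mul]
  rw [h1, vertexDegree, Finsupp.sum, monomial_sum_one, Finsupp.prod]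
  refine Finset.prod_congr rfl fun e he => ?_
  rw [if_pos (completeOn_adj.2 (hd e (Finsupp.mem_support_iff.1 he))), X, X, monomial_mul,
    monomial_pow, one_mul, one_pow]

theorem toricHom_monomial_of_not_in {p : ℕ} {A : Finset (Fin p)} {d : Pair p →₀ ℕ} {e : Pair p}
    (he : d e ≠ 0) (heA : ¬ e.In A) (c : ℝ) : toricHom A (monomial d c) = 0 := by
  classical
  rw [toricHom, aeval_monomial, Finsupp.prod,
    Finset.prod_eq_zero (Finsupp.mem_support_iff.2 he), mul_zero]
  rw [if_neg (fun h => heA (completeOn_adj.1 h)), zero_pow he]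

/-! ### The initial ideal of the toric ideal -/

/-- The leading monomial of an element of the toric ideal has the vertex degrees of a smaller
monomial, unless it is mapped to zero. -/
theorem exists_lt_of_mem_toricIdeal {p : ℕ} {A : Finset (Fin p)} {m : MonomialOrder (Pair p)}
    {f : MvPolynomial (Pair p) ℝ} (hf : f ∈ toricIdeal (completeOn A)) (hf0 : f ≠ 0)
    (hA : ∀ e, m.degree f e ≠ 0 → e.In A) :
    ∃ b, (b ≺[m] m.degree f) ∧ (∀ e, b e ≠ 0 → e.In A) ∧
      vertexDegree b = vertexDegree (m.degree f) := by
  classical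
  by_contra! hcon
  -- At this exponent the image of the leading term has to be cancelled; if no smaller monomial has
  -- the same image, its coefficient survives.
  have h0 : coeff (vertexDegree (m.degree f)) (toricHom A f) = 0 := by
    rw [mem_toricIdeal.1 hf, coeff_zero]
  have hsum : toricHom A f = ∑ b ∈ f.support, toricHom A (monomial b (coeff b f)) := by
    rw [← map_sum, ← f.as_sum]
  rw [hsum, coeff_sum, Finset.sum_eq_single (m.degree f), toricHom_monomial hA,
    coeff_monomial, if_pos rfl] at h0
  · exact m.coeff_degree_ne_zero_iff.2 hf0 h0
  · intro b hb hne
    by_cases hbA : ∀ e, b e ≠ 0 → e.In A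
    · rw [toricHom_monomial hbA, coeff_monomial, if_neg]
      exact hcon b (lt_of_le_of_ne (m.le_degree hb) fun h => hne (m.toSyn.injective h)) hbA
    · push Not at hbA
      obtain ⟨e, he, heA⟩ := hbA
      rw [toricHom_monomial_of_not_in he heA, coeff_zero]
  · intro h
    exact (h (m.degree_mem_support hf0)).elim

theorem single_add_single_le {σ : Type*} {a : σ →₀ ℕ} {e f : σ} (hef : e ≠ f) (he : a e ≠ 0)
    (hf : a f ≠ 0) : single e 1 + single f 1 ≤ a := by
  classical
  intro g
  rw [Finsupp.add_apply, single_apply, single_apply]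
  split_ifs with h1 h2 h2
  · exact (hef (h1.trans h2.symm)).elim
  · subst h1; omega
  · subst h2; omega
  · omega

/-- Every multiset of chords of `A` can be replaced by a pairwise crossing one that is not larger in
the circular order. -/
theorem exists_pairwiseCross {p : ℕ} {A : Finset (Fin p)} {m : MonomialOrder (Pair p)}
    (hm : IsCircular m) (a : Pair p →₀ ℕ) (ha : ∀ e, a e ≠ 0 → e.In A) :
    ∃ b, (b ≼[m] a) ∧ PairwiseCross b ∧ vertexDegree b = vertexDegree a := by
  have hwf : WellFounded fun a b : Pair p →₀ ℕ => a ≺[m] b := InvImage.wf m.toSyn wellFounded_lt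
  induction a using hwf.induction with
  | _ a ih =>
    by_cases hc : PairwiseCross a
    · exact ⟨a, le_rfl, hc, rfl⟩
    · simp only [PairwiseCross, not_forall] at hc
      obtain ⟨e, f, he, hf, hef⟩ := hc
      obtain ⟨g, h, hg, hh, hgc, hhc, hdeg⟩ := exists_uncross (ha e he) (ha f hf) hef
      have hne : e ≠ f := by
        rintro rfl
        exact hef (Or.inl (Or.inl rfl))
      obtain ⟨r, rfl⟩ := exists_add_of_le (single_add_single_le hne he hf)
      have hlt : single g 1 + single h 1 + r ≺[m] single e 1 + single f 1 + r := by
        have := hm.1.single_add_single_lt hgc hhc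
        rw [map_add _ _ r, map_add _ _ r]
        exact add_lt_add_left this _
      obtain ⟨b, hb, hbc, hbd⟩ := ih _ hlt (by
        classical
        intro s hs
        by_cases hr : r s = 0
        · by_cases hsg : g = s
          · exact hsg ▸ hg
          · by_cases hsh : h = s
            · exact hsh ▸ hh
            · simp [hr, hsg, hsh] at hs
        · exact ha s (by simp [hr]))
      exact ⟨b, hb.trans hlt.le, hbc, by
        rw [hbd, vertexDegree_add _ r, vertexDegree_add _ r, hdeg]⟩

/-- The ideal generated by the variables of the edges that are not in `A` and by the edges of the
initial ideal graph. -/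
noncomputable def nonCrossingIdeal {p : ℕ} (A : Finset (Fin p)) : Ideal (MvPolynomial (Pair p) ℝ) :=
  Ideal.span ({f | ∃ e : Pair p, ¬ e.In A ∧ f = X e} ∪
    {f | ∃ e g, (initialIdealGraph A).Adj e g ∧ f = X e * X g})

theorem X_mem_nonCrossingIdeal {p : ℕ} {A : Finset (Fin p)} {e : Pair p} (he : ¬ e.In A) :
    X e ∈ nonCrossingIdeal A :=
  Ideal.subset_span (Or.inl ⟨e, he, rfl⟩)

theorem X_mul_X_mem_nonCrossingIdeal {p : ℕ} {A : Finset (Fin p)} {e f : Pair p}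
    (h : (initialIdealGraph A).Adj e f) : X e * X f ∈ nonCrossingIdeal A :=
  Ideal.subset_span (Or.inr ⟨e, f, h, rfl⟩)

theorem monomial_mem_of_le {σ K : Type*} [Field K] {I : Ideal (MvPolynomial σ K)} {a b : σ →₀ ℕ}
    (hab : a ≤ b) (h : monomial a 1 ∈ I) (c : K) : monomial b c ∈ I := by
  obtain ⟨r, rfl⟩ := exists_add_of_le hab
  have := I.mul_mem_left (monomial r c) h
  rwa [monomial_mul, mul_one, add_comm] at this

/-- If a leading monomial were pairwise crossing in `A`, a smaller monomial of the same degrees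
could be uncrossed to a pairwise crossing one, which uniqueness forces to be the leading monomial
itself. -/
theorem initialIdeal_toricIdeal {p : ℕ} (A : Finset (Fin p)) {m : MonomialOrder (Pair p)}
    (hm : IsCircular m) : initialIdeal m (toricIdeal (completeOn A)) = nonCrossingIdeal A := by
  classical
  apply le_antisymm
  · rw [initialIdeal, Ideal.span_le]
    rintro _ ⟨f, hf, rfl⟩
    by_cases hf0 : f = 0
    · simp [hf0]
    by_cases hA : ∀ e, m.degree f e ≠ 0 → e.In A
    · by_cases hc : PairwiseCross (m.degree f)
      · obtain ⟨b, hb, hbA, hbd⟩ := exists_lt_of_mem_toricIdeal hf hf0 hA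
        obtain ⟨b', hb', hbc, hbd'⟩ := exists_pairwiseCross hm b hbA
        have := hc.eq_of_vertexDegree_eq hbc (hbd'.trans hbd).symm
        rw [← this] at hb'
        exact (hb.not_ge hb').elim
      · simp only [PairwiseCross, not_forall] at hc
        obtain ⟨e, g, he, hg, heg⟩ := hc
        have hne : e ≠ g := by
          rintro rfl
          exact heg (Or.inl (Or.inl rfl))
        have h1 := X_mul_X_mem_nonCrossingIdeal (A := A) (e := e) (f := g) ⟨hA e he, hA g hg, heg⟩
        rw [X, X, monomial_mul, one_mul] at h1
        exact monomial_mem_of_le (single_add_single_le hne he hg) h1 _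
    · push Not at hA
      obtain ⟨e, he, heA⟩ := hA
      exact monomial_mem_of_le (single_le_iff.2 (Nat.one_le_iff_ne_zero.2 he))
        (X_mem_nonCrossingIdeal heA) _
  · rw [nonCrossingIdeal, Ideal.span_le]
    rintro _ (⟨e, he, rfl⟩ | ⟨e, f, ⟨he, hf, hef⟩, rfl⟩)
    · refine Ideal.subset_span ⟨X e, ?_, ?_⟩
      · rw [SetLike.mem_coe, mem_toricIdeal, toricHom_X, if_neg he]
      · rw [X, m.leadingTerm_monomial]
    · obtain ⟨g, h, hg, hh, hgc, hhc, hdeg⟩ := exists_uncross he hf hef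
      have hlt := hm.1.single_add_single_lt hgc hhc
      have hin : ∀ s t : Pair p, s.In A → t.In A →
          ∀ u, (single s 1 + single t 1 : Pair p →₀ ℕ) u ≠ 0 → u.In A := by
        intro s t hs ht u hu
        by_cases h1 : s = u
        · exact h1 ▸ hs
        · by_cases h2 : t = u
          · exact h2 ▸ ht
          · simp [h1, h2] at hu
      have hd : m.degree (monomial (single g 1 + single h 1) (1 : ℝ)) ≺[m]
          m.degree (monomial (single e 1 + single f 1) (1 : ℝ)) := by
        rwa [m.degree_monomial, m.degree_monomial, if_neg one_ne_zero, if_neg one_ne_zero]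
      refine Ideal.subset_span
        ⟨monomial (single e 1 + single f 1) 1 - monomial (single g 1 + single h 1) 1, ?_, ?_⟩
      · rw [SetLike.mem_coe, mem_toricIdeal, map_sub, toricHom_monomial (hin _ _ he hf),
          toricHom_monomial (hin _ _ hg hh), hdeg, sub_self]
      · rw [MonomialOrder.leadingTerm, m.degree_sub_of_lt hd, m.leadingCoeff_sub_of_lt hd,
          m.leadingCoeff_monomial, m.degree_monomial, if_neg one_ne_zero, X, X, monomial_mul,
          one_mul]

/-! ### The join -/

/-- Joins evaluate to zero on sums of zeros. -/
theorem eval_add_eq_zero_of_mem_idealJoin {σ K : Type*} [Field K] {I J : Ideal (MvPolynomial σ K)}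
    {f : MvPolynomial σ K} (hf : f ∈ idealJoin I J) {a b : σ → K} (ha : ∀ g ∈ I, eval a g = 0)
    (hb : ∀ g ∈ J, eval b g = 0) : eval (a + b) f = 0 := by
  let z : σ ⊕ σ ⊕ σ → K := Sum.elim (a + b) (Sum.elim a b)
  have hle : Ideal.map (rename (R := K) fun i : σ => (Sum.inr (Sum.inl i) : σ ⊕ σ ⊕ σ)) I ⊔
      Ideal.map (rename (R := K) fun i : σ => (Sum.inr (Sum.inr i) : σ ⊕ σ ⊕ σ)) J ⊔
      Ideal.span (Set.range fun i : σ => (X (Sum.inr (Sum.inl i)) + X (Sum.inr (Sum.inr i)) -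
        X (Sum.inl i) : MvPolynomial (σ ⊕ σ ⊕ σ) K)) ≤ RingHom.ker (eval z) := by
    refine sup_le (sup_le ?_ ?_) ?_
    · rw [Ideal.map_le_iff_le_comap]
      intro g hg
      simpa [RingHom.mem_ker, eval_rename, Function.comp_def, z] using ha g hg
    · rw [Ideal.map_le_iff_le_comap]
      intro g hg
      simpa [RingHom.mem_ker, eval_rename, Function.comp_def, z] using hb g hg
    · rw [Ideal.span_le]
      rintro _ ⟨i, rfl⟩
      simp [RingHom.mem_ker, z]
  have := hle hf
  rw [RingHom.mem_ker] at this
  change eval z (rename _ f) = 0 at this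
  rw [eval_rename] at this
  exact this

/-- A polynomial that vanishes on a coordinate subspace contains no monomial in the
coordinates of the subspace. -/
theorem coeff_eq_zero_of_eval_eq_zero {σ K : Type*} [Field K] [Infinite K] {S : Set σ}
    {f : MvPolynomial σ K} (hf : ∀ c : σ → K, (∀ i, i ∉ S → c i = 0) → eval c f = 0)
    {u : σ →₀ ℕ} (hu : ∀ i, u i ≠ 0 → i ∈ S) : coeff u f = 0 := by
  classical
  -- Setting the variables outside `S` to zero keeps the coefficients of monomials in `S`, and the
  -- result vanishes at every point of an infinite field.
  let φ : MvPolynomial σ K →ₐ[K] MvPolynomial σ K := aeval fun i => if i ∈ S then X i else 0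
  have h0 : φ f = 0 := by
    refine MvPolynomial.funext fun t => ?_
    have : (aeval t).comp φ = (aeval fun i => if i ∈ S then t i else 0) := by
      refine MvPolynomial.algHom_ext fun i => ?_
      rw [AlgHom.comp_apply, aeval_X, aeval_X]
      split_ifs <;> simp
    rw [map_zero]
    exact (DFunLike.congr_fun this f).trans (hf _ fun i hi => if_neg hi)
  have hmon : ∀ d : σ →₀ ℕ, ∀ c : K, φ (monomial d c) =
      if ∀ i, d i ≠ 0 → i ∈ S then monomial d c else 0 := by
    intro d c
    rw [aeval_monomial, Finsupp.prod]
    split_ifs with hd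
    · rw [monomial_eq (s := d), Finsupp.prod]
      change C c * _ = _
      congr 1
      exact Finset.prod_congr rfl fun i hi => by rw [if_pos (hd i (Finsupp.mem_support_iff.1 hi))]
    · push Not at hd
      obtain ⟨i, hi, hiS⟩ := hd
      rw [Finset.prod_eq_zero (Finsupp.mem_support_iff.2 hi), mul_zero]
      rw [if_neg hiS, zero_pow hi]
  have h1 : coeff u (φ f) = coeff u f := by
    conv_lhs => rw [f.as_sum, map_sum, coeff_sum]
    conv_rhs => rw [f.as_sum, coeff_sum]
    refine Finset.sum_congr rfl fun d _ => ?_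
    rw [hmon]
    split_ifs with hd
    · rfl
    · rw [coeff_monomial, if_neg, coeff_zero]
      rintro rfl
      exact hd hu
  rw [← h1, h0, coeff_zero]

/-- The points supported on pairwise crossing edges in `A` are zeros of the non-crossing ideal. -/
theorem eval_eq_zero_of_mem_nonCrossingIdeal {p : ℕ} {A : Finset (Fin p)} {a : Pair p → ℝ}
    (hA : ∀ e, a e ≠ 0 → e.In A) (hc : ∀ e f, a e ≠ 0 → a f ≠ 0 → e.Cross f)
    {g : MvPolynomial (Pair p) ℝ} (hg : g ∈ nonCrossingIdeal A) : eval a g = 0 := by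
  have hle : nonCrossingIdeal A ≤ RingHom.ker (eval a) := by
    rw [nonCrossingIdeal, Ideal.span_le]
    rintro _ (⟨e, he, rfl⟩ | ⟨e, f, h, rfl⟩)
    · rw [SetLike.mem_coe, RingHom.mem_ker, eval_X]
      exact not_not.1 fun h => he (hA e h)
    · rw [SetLike.mem_coe, RingHom.mem_ker, map_mul, eval_X, eval_X, mul_eq_zero]
      by_contra! h0
      exact h.2.2 (hc e f h0.1 h0.2)
  exact hle hg

/-- Membership in a join can be checked modulo the relations `x i = y₁ i + y₂ i`. -/
theorem mem_idealJoin_of_bind {σ K : Type*} [Field K] {I J : Ideal (MvPolynomial σ K)}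
    {f : MvPolynomial σ K}
    (h : aeval (fun i => (X (Sum.inr (Sum.inl i)) + X (Sum.inr (Sum.inr i)) :
        MvPolynomial (σ ⊕ σ ⊕ σ) K)) f ∈
      Ideal.map (rename (R := K) fun i : σ => (Sum.inr (Sum.inl i) : σ ⊕ σ ⊕ σ)) I ⊔
      Ideal.map (rename (R := K) fun i : σ => (Sum.inr (Sum.inr i) : σ ⊕ σ ⊕ σ)) J) :
    f ∈ idealJoin I J := by
  rw [idealJoin, Ideal.mem_comap]
  set N := Ideal.span (Set.range fun i : σ => (X (Sum.inr (Sum.inl i)) + X (Sum.inr (Sum.inr i)) -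
        X (Sum.inl i) : MvPolynomial (σ ⊕ σ ⊕ σ) K)) with hN
  -- Modulo the linear relations, renaming to `x` and substituting `y₁ + y₂` agree on variables,
  -- hence everywhere.
  have hcongr : (Ideal.Quotient.mkₐ K N).comp (rename Sum.inl) = (Ideal.Quotient.mkₐ K N).comp
      (aeval (fun i => (X (Sum.inr (Sum.inl i)) + X (Sum.inr (Sum.inr i)) :
        MvPolynomial (σ ⊕ σ ⊕ σ) K))) := by
    refine MvPolynomial.algHom_ext fun i => ?_
    rw [AlgHom.comp_apply, AlgHom.comp_apply, rename_X, aeval_X, eq_comm]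
    exact Ideal.Quotient.eq.2 (Ideal.subset_span ⟨i, rfl⟩)
  have hsub := Ideal.Quotient.eq.1 (DFunLike.congr_fun hcongr f)
  have := add_mem (Ideal.mem_sup_right hsub) (Ideal.mem_sup_left h)
  exact (sub_add_cancel (rename Sum.inl f) _ ▸ this :)

/-! ### Combinatorics of the glued hypergraph and the two inclusions -/

theorem eq_of_in_of_in {p : ℕ} {A₁ A₂ : Finset (Fin p)} {j₁ j₂ : Fin p} {hj : j₁ < j₂}
    (hA : A₁ ∩ A₂ = {j₁, j₂}) {e : Pair p} (h₁ : e.In A₁) (h₂ : e.In A₂) : e = ⟨(j₁, j₂), hj⟩ := by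
  have h1 : e.1.1 ∈ A₁ ∩ A₂ := Finset.mem_inter.2 ⟨h₁.1, h₂.1⟩
  have h2 : e.1.2 ∈ A₁ ∩ A₂ := Finset.mem_inter.2 ⟨h₁.2, h₂.2⟩
  have h3 := e.2
  rw [hA, Finset.mem_insert, Finset.mem_singleton] at h1 h2
  refine Subtype.ext (Prod.ext ?_ ?_)
  · rcases h1 with h | h
    · exact h
    · rcases h2 with h' | h'
      · rw [h, h'] at h3
        exact (lt_asymm hj h3).elim
      · rw [h, h'] at h3
        exact (lt_irrefl _ h3).elim
  · rcases h2 with h | h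
    · rcases h1 with h' | h'
      · rw [h, h'] at h3
        exact (lt_irrefl _ h3).elim
      · rw [h, h'] at h3
        exact (lt_asymm hj h3).elim
    · exact h

theorem isIsolated_gluedHypergraph {p : ℕ} {A₁ A₂ : Finset (Fin p)} {e₀ : Pair p}
    (h₁ : e₀.In A₁) (h₂ : e₀.In A₂) (v : Pair p) :
    (v ∈ (gluedHypergraph A₁ A₂ e₀).vertexSet ∧ (gluedHypergraph A₁ A₂ e₀).IsIsolated v) ↔
      ¬ v.In A₁ ∧ ¬ v.In A₂ := by
  constructor
  · rintro ⟨hv, hi⟩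
    rw [← not_or]
    exact fun h => hv ⟨h, hi⟩
  · rintro ⟨h1, h2⟩
    refine ⟨fun h => h.1.elim h1 h2, ?_⟩
    rintro _ (⟨a, b, hab, -, -, rfl⟩ | ⟨a, b, ha, hb, rfl⟩) hv
    · rcases hv with rfl | rfl
      · exact hab.elim (fun h => h1 h.1) (fun h => h2 h.1)
      · exact hab.elim (fun h => h1 h.2.1) (fun h => h2 h.2.1)
    · rcases hv with rfl | rfl | rfl
      · exact h1 ha.1
      · exact h1 h₁
      · exact h2 hb.2.1

theorem monomial_mem_monomialEdgeIdeal {σ K : Type*} [Field K] {H : Hypergraph σ} {s : Finset σ}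
    (hs : (s : Set σ) ∈ H.edgeSet) {u : σ →₀ ℕ} (hu : ∀ i ∈ s, u i ≠ 0) (c : K) :
    monomial u c ∈ monomialEdgeIdeal K H := by
  classical
  have hle : ∑ i ∈ s, single i 1 ≤ u := by
    intro j
    rw [Finsupp.finsetSum_apply]
    by_cases hj : j ∈ s
    · simpa [single_apply, hj] using Nat.one_le_iff_ne_zero.2 (hu j hj)
    · simp [single_apply, hj]
  refine monomial_mem_of_le hle ?_ c
  rw [monomial_sum_one]
  exact Ideal.subset_span (Or.inl ⟨s, hs, rfl⟩)

/-- A monomial outside the edge ideal of the glued hypergraph is supported on the union of a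
pairwise crossing set of edges in `A₁` and one of edges in `A₂`. -/
theorem exists_crossing_cover {p : ℕ} {A₁ A₂ : Finset (Fin p)} {e₀ : Pair p} {u : Pair p →₀ ℕ}
    (hu : monomial u (1 : ℝ) ∉ monomialEdgeIdeal ℝ (gluedHypergraph A₁ A₂ e₀))
    (h₁ : e₀.In A₁) (h₂ : e₀.In A₂) :
    ∃ F G : Set (Pair p), (∀ e ∈ F, e.In A₁) ∧ (∀ e ∈ G, e.In A₂) ∧
      (∀ e ∈ F, ∀ f ∈ F, e.Cross f) ∧ (∀ e ∈ G, ∀ f ∈ G, e.Cross f) ∧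
      ∀ e, u e ≠ 0 → e ∈ F ∪ G := by
  classical
  have hin : ∀ e, u e ≠ 0 → e.In A₁ ∨ e.In A₂ := by
    intro e he
    by_contra! h
    obtain ⟨hv, hi⟩ := (isIsolated_gluedHypergraph h₁ h₂ e).2 h
    exact hu (monomial_mem_of_le (single_le_iff.2 (Nat.one_le_iff_ne_zero.2 he))
      (Ideal.subset_span (Or.inr ⟨e, hv, hi, rfl⟩)) 1)
  have hedge : ∀ s : Finset (Pair p), (s : Set (Pair p)) ∈ gluedEdges A₁ A₂ e₀ →
      ∃ e ∈ s, u e = 0 := by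
    intro s hs
    by_contra! h
    exact hu (monomial_mem_monomialEdgeIdeal (H := gluedHypergraph A₁ A₂ e₀) hs h 1)
  have hpair : ∀ e f, u e ≠ 0 → u f ≠ 0 → e ≠ e₀ → f ≠ e₀ →
      ¬ ((initialIdealGraph A₁).Adj e f ∨ (initialIdealGraph A₂).Adj e f) := by
    intro e f he hf he0 hf0 h
    obtain ⟨g, hg, hg0⟩ := hedge {e, f} (Or.inl ⟨e, f, h, he0, hf0, by simp⟩)
    rw [Finset.mem_insert, Finset.mem_singleton] at hg
    rcases hg with rfl | rfl
    · exact he hg0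
    · exact hf hg0
  have hself : ∀ e : Pair p, e.Cross e := fun e => Or.inl (Or.inl rfl)
  have hcross : ∀ B : Finset (Fin p), (B = A₁ ∨ B = A₂) → ∀ e f, e.In B → f.In B → u e ≠ 0 →
      u f ≠ 0 → e ≠ e₀ → f ≠ e₀ → e.Cross f := by
    intro B hB e f he hf hue huf he0 hf0
    by_contra h
    refine hpair e f hue huf he0 hf0 ?_
    rcases hB with rfl | rfl
    · exact Or.inl ⟨he, hf, h⟩
    · exact Or.inr ⟨he, hf, h⟩
  have extend : ∀ B : Finset (Fin p), (B = A₁ ∨ B = A₂) →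
      (∀ e, e.In B → u e ≠ 0 → e.Cross e₀) →
      ∀ e ∈ {e : Pair p | e.In B ∧ u e ≠ 0}, ∀ f ∈ {e : Pair p | e.In B ∧ u e ≠ 0},
        e.Cross f := by
    rintro B hB h e ⟨he, hue⟩ f ⟨hf, huf⟩
    by_cases he0 : e = e₀
    · rw [he0]
      exact (h f hf huf).symm
    · by_cases hf0 : f = e₀
      · rw [hf0]
        exact h e he hue
      · exact hcross B hB e f he hf hue huf he0 hf0
  have remove : ∀ B : Finset (Fin p), (B = A₁ ∨ B = A₂) →
      ∀ e ∈ {e : Pair p | e.In B ∧ u e ≠ 0 ∧ e ≠ e₀},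
      ∀ f ∈ {e : Pair p | e.In B ∧ u e ≠ 0 ∧ e ≠ e₀}, e.Cross f := by
    rintro B hB e ⟨he, hue, he0⟩ f ⟨hf, huf, hf0⟩
    exact hcross B hB e f he hf hue huf he0 hf0
  -- Only the side that receives `e₀` is in question. It goes to `F` if it crosses every chord of
  -- `A₁` in the support, and otherwise to `G`.
  by_cases hc : ∀ e, e.In A₁ → u e ≠ 0 → u e₀ ≠ 0 → e.Cross e₀
  · by_cases hu0 : u e₀ = 0
    · refine ⟨{e | e.In A₁ ∧ u e ≠ 0 ∧ e ≠ e₀}, {e | e.In A₂ ∧ u e ≠ 0 ∧ e ≠ e₀},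
        fun e he => he.1, fun e he => he.1, remove _ (Or.inl rfl), remove _ (Or.inr rfl),
        fun e he => ?_⟩
      have hne : e ≠ e₀ := fun h => he (h ▸ hu0)
      exact (hin e he).imp (fun h => ⟨h, he, hne⟩) fun h => ⟨h, he, hne⟩
    · refine ⟨{e | e.In A₁ ∧ u e ≠ 0}, {e | e.In A₂ ∧ u e ≠ 0 ∧ e ≠ e₀},
        fun e he => he.1, fun e he => he.1, extend _ (Or.inl rfl) fun e he hue => hc e he hue hu0,
        remove _ (Or.inr rfl), fun e he => ?_⟩
      by_cases hne : e = e₀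
      · exact Or.inl ⟨hne ▸ h₁, he⟩
      · exact (hin e he).imp (fun h => ⟨h, he⟩) fun h => ⟨h, he, hne⟩
  · push Not at hc
    obtain ⟨a, ha, hua, hu0, hac⟩ := hc
    refine ⟨{e | e.In A₁ ∧ u e ≠ 0 ∧ e ≠ e₀}, {e | e.In A₂ ∧ u e ≠ 0},
      fun e he => he.1, fun e he => he.1, remove _ (Or.inl rfl), extend _ (Or.inr rfl) ?_,
      fun e he => ?_⟩
    · intro b hb hub
      by_contra hbc
      -- As `a` misses `e₀`, a chord `b` of `A₂` that also misses it would complete a hyperedge of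
      -- size 3 in the support.
      obtain ⟨g, hg, hg0⟩ := hedge {a, e₀, b} (Or.inr ⟨a, b, ⟨ha, h₁, hac⟩,
        ⟨h₂, hb, fun h => hbc h.symm⟩, by simp⟩)
      rw [Finset.mem_insert, Finset.mem_insert, Finset.mem_singleton] at hg
      rcases hg with rfl | rfl | rfl
      · exact hua hg0
      · exact hu0 hg0
      · exact hub hg0
    · by_cases hne : e = e₀
      · exact Or.inr ⟨hne ▸ h₂, he⟩
      · exact (hin e he).imp (fun h => ⟨h, he, hne⟩) fun h => ⟨h, he⟩

theorem idealJoin_le_monomialEdgeIdeal {p : ℕ} {A₁ A₂ : Finset (Fin p)} {e₀ : Pair p}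
    (h₁ : e₀.In A₁) (h₂ : e₀.In A₂) :
    idealJoin (nonCrossingIdeal A₁) (nonCrossingIdeal A₂) ≤
      monomialEdgeIdeal ℝ (gluedHypergraph A₁ A₂ e₀) := by
  classical
  intro f hf
  rw [f.as_sum]
  refine sum_mem fun u hu => ?_
  by_contra hmem
  obtain ⟨F, G, hF, hG, hFc, hGc, hcov⟩ :=
    exists_crossing_cover (fun h => hmem (monomial_mem_of_le le_rfl h _)) h₁ h₂
  refine (MvPolynomial.mem_support_iff.1 hu) (coeff_eq_zero_of_eval_eq_zero (S := F ∪ G) ?_ hcov)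
  intro c hc
  -- Coordinates in both `F` and `G` are assigned to the first summand.
  have hsum : c = (fun e => if e ∈ F then c e else 0) + fun e => if e ∈ F then 0 else c e := by
    funext e
    by_cases he : e ∈ F <;> simp [he]
  have hmF : ∀ e, (if e ∈ F then c e else 0) ≠ 0 → e ∈ F := fun e h => by
    by_contra he
    exact h (if_neg he)
  have hmG : ∀ e, (if e ∈ F then 0 else c e) ≠ 0 → e ∈ G := fun e h => by
    by_cases he : e ∈ F
    · exact (h (if_pos he)).elim
    · rw [if_neg he] at h
      by_contra heG
      exact h (hc e fun h' => h'.elim he heG)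
  rw [hsum]
  exact eval_add_eq_zero_of_mem_idealJoin hf
    (fun g hg => eval_eq_zero_of_mem_nonCrossingIdeal (fun e he => hF e (hmF e he))
      (fun e f he hf => hFc e (hmF e he) f (hmF f hf)) hg)
    (fun g hg => eval_eq_zero_of_mem_nonCrossingIdeal (fun e he => hG e (hmG e he))
      (fun e f he hf => hGc e (hmG e he) f (hmG f hf)) hg)

/-- Only `e₀` lies in both complete graphs. Any other edge of one graph therefore has its variable
for the opposite factor in `M`, and most terms of the expansion disappear. -/
theorem monomialEdgeIdeal_le_idealJoin {p : ℕ} {A₁ A₂ : Finset (Fin p)} {j₁ j₂ : Fin p}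
    {hj : j₁ < j₂} (hA : A₁ ∩ A₂ = {j₁, j₂}) (h₁ : Pair.In ⟨(j₁, j₂), hj⟩ A₁)
    (h₂ : Pair.In ⟨(j₁, j₂), hj⟩ A₂) :
    monomialEdgeIdeal ℝ (gluedHypergraph A₁ A₂ ⟨(j₁, j₂), hj⟩) ≤
      idealJoin (nonCrossingIdeal A₁) (nonCrossingIdeal A₂) := by
  classical
  let y₁ : Pair p → Pair p ⊕ Pair p ⊕ Pair p := fun i => Sum.inr (Sum.inl i)
  let y₂ : Pair p → Pair p ⊕ Pair p ⊕ Pair p := fun i => Sum.inr (Sum.inr i)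
  set e₀ : Pair p := ⟨(j₁, j₂), hj⟩ with he₀
  set M := Ideal.map (rename (R := ℝ) y₁) (nonCrossingIdeal A₁) ⊔
    Ideal.map (rename (R := ℝ) y₂) (nonCrossingIdeal A₂) with hM
  have hy₁ : ∀ g ∈ nonCrossingIdeal A₁, rename y₁ g ∈ M := fun g hg =>
    Ideal.mem_sup_left (Ideal.mem_map_of_mem _ hg)
  have hy₂ : ∀ g ∈ nonCrossingIdeal A₂, rename y₂ g ∈ M := fun g hg =>
    Ideal.mem_sup_right (Ideal.mem_map_of_mem _ hg)
  have hX₁ : ∀ e : Pair p, ¬ e.In A₁ → (X (y₁ e) : MvPolynomial _ ℝ) ∈ M := fun e he => by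
    simpa using hy₁ _ (X_mem_nonCrossingIdeal he)
  have hX₂ : ∀ e : Pair p, ¬ e.In A₂ → (X (y₂ e) : MvPolynomial _ ℝ) ∈ M := fun e he => by
    simpa using hy₂ _ (X_mem_nonCrossingIdeal he)
  have hXX₁ : ∀ e f : Pair p, (initialIdealGraph A₁).Adj e f →
      (X (y₁ e) * X (y₁ f) : MvPolynomial _ ℝ) ∈ M := fun e f h => by
    simpa using hy₁ _ (X_mul_X_mem_nonCrossingIdeal h)
  have hXX₂ : ∀ e f : Pair p, (initialIdealGraph A₂).Adj e f →
      (X (y₂ e) * X (y₂ f) : MvPolynomial _ ℝ) ∈ M := fun e f h => by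
    simpa using hy₂ _ (X_mul_X_mem_nonCrossingIdeal h)
  have hnot₂ : ∀ e : Pair p, e.In A₁ → e ≠ e₀ → ¬ e.In A₂ := fun e h1 hne h2 =>
    hne (eq_of_in_of_in hA h1 h2)
  have hnot₁ : ∀ e : Pair p, e.In A₂ → e ≠ e₀ → ¬ e.In A₁ := fun e h2 hne h1 =>
    hne (eq_of_in_of_in hA h1 h2)
  rw [monomialEdgeIdeal, Ideal.span_le]
  rintro _ (⟨s, hs, rfl⟩ | ⟨v, hv, hi, rfl⟩)
  · refine mem_idealJoin_of_bind ?_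
    change _ ∈ M
    rcases hs with ⟨a, b, hab, ha, hb, hs⟩ | ⟨a, b, ha, hb, hs⟩
    · have hne : a ≠ b := by
        rcases hab with h | h
        · exact h.ne
        · exact h.ne
      have hs' : s = {a, b} := by
        rw [← Finset.coe_inj, hs]; simp
      rw [hs', Finset.prod_pair hne, map_mul, aeval_X, aeval_X]
      rcases hab with h | h
      · have := add_mem (hXX₁ a b h) (add_mem (M.mul_mem_left (X (y₁ a)) (hX₂ b (hnot₂ b h.2.1 hb)))
          (M.mul_mem_right (X (y₁ b) + X (y₂ b)) (hX₂ a (hnot₂ a h.1 ha))))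
        convert this using 1
        ring
      · have := add_mem (hXX₂ a b h) (add_mem (M.mul_mem_left (X (y₂ a)) (hX₁ b (hnot₁ b h.2.1 hb)))
          (M.mul_mem_right (X (y₁ b) + X (y₂ b)) (hX₁ a (hnot₁ a h.1 ha))))
        convert this using 1
        ring
    · have ha' := hX₂ a (hnot₂ a ha.1 ha.ne)
      have hb' := hX₁ b (hnot₁ b hb.2.1 hb.ne')
      have hab : a ≠ b := by
        rintro rfl
        exact hnot₂ a ha.1 ha.ne hb.2.1
      have hs' : s = {a, e₀, b} := by
        rw [← Finset.coe_inj, hs]; simp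
      rw [hs', Finset.prod_insert (by simp [ha.ne, hab]), Finset.prod_pair hb.ne, map_mul, map_mul,
        aeval_X, aeval_X, aeval_X]
      -- Modulo `y₂ a` and `y₁ b`, the product is `y₁ a * (y₁ e₀ + y₂ e₀) * y₂ b`; one term contains
      -- an edge of the first graph, the other an edge of the second.
      have := add_mem (add_mem (M.mul_mem_right (X (y₂ b)) (hXX₁ a e₀ ha))
          (M.mul_mem_left (X (y₁ a)) (hXX₂ e₀ b hb)))
        (add_mem (M.mul_mem_right ((X (y₁ e₀) + X (y₂ e₀)) * (X (y₁ b) + X (y₂ b))) ha')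
          (M.mul_mem_left (X (y₁ a) * (X (y₁ e₀) + X (y₂ e₀))) hb'))
      convert this using 1
      ring
  · obtain ⟨h1, h2⟩ := (isIsolated_gluedHypergraph h₁ h₂ v).1 ⟨hv, hi⟩
    refine mem_idealJoin_of_bind ?_
    rw [aeval_X]
    exact add_mem (hX₁ v h1) (hX₂ v h2)

end SparseFactor

theorem mainTheorem8 (p : ℕ) (A₁ A₂ : Finset (Fin p)) (j₁ j₂ : Fin p) (hj : j₁ < j₂)
    (hA : A₁ ∩ A₂ = {j₁, j₂}) (m : MonomialOrder (SparseFactor.Pair p))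
    (hm : SparseFactor.IsCircular m) :
    SparseFactor.oneFactorIdeal A₁ = SparseFactor.toricIdeal (SparseFactor.completeOn A₁) ∧
    SparseFactor.oneFactorIdeal A₂ = SparseFactor.toricIdeal (SparseFactor.completeOn A₂) ∧
    SparseFactor.idealJoin
        (SparseFactor.initialIdeal m (SparseFactor.oneFactorIdeal A₁))
        (SparseFactor.initialIdeal m (SparseFactor.oneFactorIdeal A₂)) =
      SparseFactor.monomialEdgeIdeal ℝ
        (SparseFactor.gluedHypergraph A₁ A₂ ⟨(j₁, j₂), hj⟩) := by
  have hj₁ : j₁ ∈ A₁ ∩ A₂ := by simp [hA]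
  have hj₂ : j₂ ∈ A₁ ∩ A₂ := by simp [hA]
  rw [Finset.mem_inter] at hj₁ hj₂
  refine ⟨SparseFactor.oneFactorIdeal_eq_toricIdeal A₁,
    SparseFactor.oneFactorIdeal_eq_toricIdeal A₂, ?_⟩
  rw [SparseFactor.oneFactorIdeal_eq_toricIdeal, SparseFactor.oneFactorIdeal_eq_toricIdeal,
    SparseFactor.initialIdeal_toricIdeal _ hm, SparseFactor.initialIdeal_toricIdeal _ hm]
  exact le_antisymm
    (SparseFactor.idealJoin_le_monomialEdgeIdeal ⟨hj₁.1, hj₂.1⟩ ⟨hj₁.2, hj₂.2⟩)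
    (SparseFactor.monomialEdgeIdeal_le_idealJoin hA ⟨hj₁.1, hj₂.1⟩ ⟨hj₁.2, hj₂.2⟩)
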